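/- Let $C_1,\dots,C_m$ be disjoint communities of (unknown) sizes $d_i\ge 1$, let $\mu_i=1/d_i$, $D=\sum_{i=1}^m d_i$, and let $K>m$ be the exploration budget of a round. In each round $t=1,2,\dots$ a realization $\Phi_t$ assigns to each item $(i,\tau)$, $i\in[m]$, $\tau\in[K]$, the member $\Phi_t(i,\tau)$ met in the $\tau$-th exploration of $C_i$; all these members are independent and $\Phi_t(i,\tau)$ is uniform on $C_i$. A policy $\pi$ chooses the next community to explore as a function of the partial realization $\psi$, i.e. of the members met so far in each community; $\pi_K(\phi)$ is the vector of the numbers of explorations of the communities after $K$ steps, $R(\bm k,\phi)=\sum_i|\{\phi(i,\tau):\tau\le k_i\}|$ is the reward, and $r_\pi=\mathbb E[R(\pi_K(\Phi),\Phi)]$. Let $c_i(\psi)$ be the number of distinct members of $C_i$ met in $\psi$, and let $\pi^*$ be a policy that maximizes $r_\pi$. Consider the CLCB algorithm with adaptive exploration and full information feedback. It starts with $T_i=X_i=0$, $\hat\mu_i=0$. In round $t$ it uses a policy $\pi^{t}$ that in each of its $K$ steps explores a community $i\in\arg\max_{i}\,(1-c_i(\psi)\hat\mu_i)$. Ties may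 be broken in any way that depends on the past feedback, on $\psi$ and on internal randomness independent of the realizations, except that a community not yet explored in the round is preferred as long as there is one (its value $1$ is always maximal), so that every community is explored in every round. If $u_1,\dots,u_n$ are the members of $C_i$ met in the round, in this order, and $u_0$ is the last member of $C_i$ met in the previous round ($u_0=\mathrm{null}$ if $t=1$), then at the end of the round $T_i\leftarrow T_i+n-\mathbb 1\{t=1\}$, $X_i\leftarrow X_i+\sum_{x=0}^{n-1}\mathbb 1\{u_x=u_{x+1}\}$, and $\hat\mu_i\leftarrow X_i/T_i$ ($\hat\mu_i=0$ while $T_i=0$). Its regret is $\mathrm{Reg}(T)=\mathbb E\big[\sum_{t=1}^T R(\pi^*_K(\Phi_t),\Phi_t)-R(\pi^{t}_K(\Phi_t),\Phi_t)\big]$. Then the regret is bounded by a constant: there is a $C$ that depends only on $d_1,\dots,d_m$ and $K$ such that $\mathrm{Reg}(T)\le C$ for all $T$. Specifically, let $\pi^g$ be a greedy policy: it always explores a community $i\in\arg\max_i(1-\mu_ic_i(\psi))$, and its choice depends only on $(c_1(\psi),\dots,c_m(\psi))$. Let $U_{i,k}$ be the number of times that $\pi^g$ selects $C_i$ in its first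 $k-1$ steps under a realization in which the first $d_j$ explorations of each $C_j$ meet distinct members. Let $\Pi_k$ be the set of the policies that make the same choice as $\pi^g$ at every partial realization $\psi$ with $c_i(\psi)\le U_{i,k}$ for all $i$ and $c_i(\psi)<U_{i,k}$ for at least one $i$, and let $\Delta^{(k)}_{\max}=\max_{\pi\in\Pi_k}(r_{\pi^g}-r_\pi)$. For each $k$ choose any $i^*_k\in\arg\min_{i}\mu_iU_{i,k}$, and let $$\varepsilon_{i,k}=\frac{\mu_iU_{i,k}-\mu_{i^*_k}U_{i^*_k,k}}{U_{i,k}+U_{i^*_k,k}}\quad(i\ne i^*_k),\qquad \varepsilon_{i^*_k,k}=\infty .$$ Then for all $T$ $$\mathrm{Reg}(T)\le\sum_{i=1}^m\ \sum_{k=m+1}^{\min\{K,D\}}\Big(\frac{2}{\varepsilon_{i,k}^4}+1\Big)\Delta^{(k)}_{\max},$$ where $2/\infty=0$, $2/0=\infty$ and $\infty\cdot 0=0$ (so the right-hand side can be infinite if the minimizer of $\mu_iU_{i,k}$ is not unique for some $k$). -/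

import Mathlib

open scoped BigOperators ENNReal
open MeasureTheory

namespace CommunityExploration

/-- A realization: `φ i τ` is the member of community `C_i` (a set with `d i` elements) met in the
`τ`-th exploration of `C_i`, for each of the `m * K` items `(i, τ)` (`τ` is counted from `0`). -/
abbrev Realization {m : ℕ} (d : Fin m → ℕ) (K : ℕ) : Type := (i : Fin m) → Fin K → Fin (d i)

/-- A partial realization: for each community the list of the members met so far, in the order of
the explorations of that community. -/
abbrev PartialRealization {m : ℕ} (d : Fin m → ℕ) : Type := (i : Fin m) → List (Fin (d i))

/-- A policy chooses the next community to explore from the current partial realization. -/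
abbrev Policy {m : ℕ} (d : Fin m → ℕ) : Type := PartialRealization d → Fin m

variable {m : ℕ} {d : Fin m → ℕ} {K : ℕ}

/-- What is observed under `φ` when each community `C_i` has been explored `k i` times. -/
def observed (φ : Realization d K) (k : Fin m → ℕ) : PartialRealization d :=
  fun i => (List.ofFn (φ i)).take (k i)

/-- `c_i(ψ)`: the number of distinct members of `C_i` met in `ψ`. -/
def met (ψ : PartialRealization d) (i : Fin m) : ℕ := (ψ i).toFinset.card

/-- How often each community has been explored after `s` steps of policy `π` under `φ`;
`s = K` gives the exploration vector `π_K(φ)`. -/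
def explored (π : Policy d) (φ : Realization d K) : ℕ → Fin m → ℕ
  | 0 => 0
  | s + 1 => explored π φ s + Pi.single (π (observed φ (explored π φ s))) 1

/-- The reward `R(k, φ)`: the number of distinct members met. -/
def reward (k : Fin m → ℕ) (φ : Realization d K) : ℝ :=
  ∑ i, (met (observed φ k) i : ℝ)

/-- The expected reward `r_π` with budget `K`. The members `Φ(i, τ)` are independent and uniform,
so `Φ` is uniform on the finite set of all realizations; `𝔼` is the average over it. -/
noncomputable def expectedReward (K : ℕ) (π : Policy d) : ℝ :=
  𝔼 φ : Realization d K, reward (explored π φ K) φ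

/-- An optimal policy for budget `K`. -/
def IsOptimal (K : ℕ) (π : Policy d) : Prop :=
  ∀ π' : Policy d, expectedReward K π' ≤ expectedReward K π

/-- The parameter `μ_i = 1 / d_i`. -/
noncomputable def mu (d : Fin m → ℕ) (i : Fin m) : ℝ := 1 / (d i : ℝ)

/-- A greedy policy `π^g`: it explores a community that maximizes `1 - μ_i c_i(ψ)`, and its choice
depends only on the numbers of distinct members met. -/
def IsGreedy (π : Policy d) : Prop :=
  (∀ ψ j, 1 - mu d j * met ψ j ≤ 1 - mu d (π ψ) * met ψ (π ψ)) ∧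
  ∀ ψ ψ' : PartialRealization d, met ψ = met ψ' → π ψ = π ψ'

/-! ### The learning algorithm -/

/-- What the learner stores about a community with `n` members: the number of completed rounds,
the number of pairs `T_i`, the number of collisions `X_i`, and the last member met
(`none` at the beginning). -/
structure PairStats (n : ℕ) where
  rounds : ℕ
  pairs : ℕ
  collisions : ℕ
  last : Option (Fin n)

/-- The statistics before the first round. -/
def PairStats.init (n : ℕ) : PairStats n := ⟨0, 0, 0, none⟩

/-- The update at the end of a round in which the members in the list `S` were met, in this order.
With `u_0` the last member met before and `u_1, u_2, …` the elements of `S`,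
`T_i ← T_i + |S| - 1{t = 1}` and `X_i ← X_i + ∑_{x < |S|} 1{u_x = u_{x+1}}`. -/
def PairStats.update {n : ℕ} (s : PairStats n) (S : List (Fin n)) : PairStats n :=
  let u : List (Option (Fin n)) := s.last :: S.map some
  { rounds := s.rounds + 1
    pairs := s.pairs + (S.length - if s.rounds = 0 then 1 else 0)
    collisions := s.collisions + (u.zip u.tail).countP (fun p => decide (p.1 = p.2))
    last := u.getLast (List.cons_ne_nil _ _) }

/-- The feedback of the past rounds in chronological order: one partial realization per round. -/
abbrev Feedback {m : ℕ} (d : Fin m → ℕ) : Type := List (PartialRealization d)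

/-- The statistics of community `C_i` after the rounds recorded in `h`. -/
def stats (h : Feedback d) (i : Fin m) : PairStats (d i) :=
  h.foldl (fun s ψ => s.update (ψ i)) (PairStats.init (d i))

/-- The empirical mean `X_i / T_i`; it is `0`, its initial value, as long as `T_i = 0`. -/
noncomputable def muHat (h : Feedback d) (i : Fin m) : ℝ :=
  ((stats h i).collisions : ℝ) / ((stats h i).pairs : ℝ)

/-- An adaptive learning algorithm: it selects the policy of the next round from the feedback. -/
abbrev Learner {m : ℕ} (d : Fin m → ℕ) : Type := Feedback d → Policy d

/-- `A` is the adaptive CLCB algorithm with full information feedback: in each round it explores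
a community that maximizes `1 - c_i(ψ) * μ̂_i`. Ties are broken arbitrarily, except that, as long as
some community has not been explored in the current round, such a community (whose index `1` is
maximal) is preferred, so that every community is explored in every round. -/
def IsFullInfoCLCB (A : Learner d) : Prop :=
  ∀ h ψ,
    (∀ j, 1 - met ψ j * muHat h j ≤ 1 - met ψ (A h ψ) * muHat h (A h ψ)) ∧
    ((∃ j, ψ j = []) → ψ (A h ψ) = [])

/-- The feedback collected by `A` when the realizations of the successive rounds are `φs`. -/
def feedback (A : Learner d) (φs : List (Realization d K)) : Feedback d :=
  φs.foldl (fun h φ => h ++ [observed φ (explored (A h) φ K)]) []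

/-- The `T`-round adaptive regret of `A` relative to the policy `πstar`. The average is over the
independent realizations `Φ_1, …, Φ_T` of the `T` rounds. -/
noncomputable def regret (K : ℕ) (πstar : Policy d) (A : Learner d) (T : ℕ) : ℝ :=
  𝔼 Φ : Fin T → Realization d K, ∑ t : Fin T,
    (reward (explored πstar (Φ t) K) (Φ t)
      - reward (explored (A (feedback A ((List.ofFn Φ).take t))) (Φ t) K) (Φ t))

/-- The regret of an algorithm that may randomize (for instance to break ties): `A ξ` is the
algorithm with internal random seed `ξ`, which has law `ν` and is independent of the realizations. -/
noncomputable def randomizedRegret {Ξ : Type*} [MeasurableSpace Ξ] (ν : Measure Ξ)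
    (K : ℕ) (πstar : Policy d) (A : Ξ → Learner d) (T : ℕ) : ℝ :=
  ∫ ξ, regret K πstar (A ξ) T ∂ν

/-! ### The quantities in the bound -/

/-- A full realization in which the first `d i` explorations of `C_i` meet distinct members. -/
def distinctRealization (d : Fin m → ℕ) [∀ i, NeZero (d i)] (K : ℕ) : Realization d K :=
  fun i τ => Fin.ofNat (d i) τ

/-- `U_{i,k}`: how often `πg` selects `C_i` in the first `k - 1` steps under a realization whose
first explorations meet distinct members. -/
def U [∀ i, NeZero (d i)] (K : ℕ) (πg : Policy d) (k : ℕ) (i : Fin m) : ℕ :=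
  explored πg (distinctRealization d K) (k - 1) i

/-- `Π_k`: the policies that choose as `πg` does until `U_{i,k}` distinct members have been met in
every community `C_i`. -/
def policiesAgreeing [∀ i, NeZero (d i)] (K : ℕ) (πg : Policy d) (k : ℕ) : Set (Policy d) :=
  {π | ∀ ψ : PartialRealization d,
    (∀ i, met ψ i ≤ U K πg k i) → (∃ i, met ψ i < U K πg k i) → π ψ = πg ψ}

/-- `Δ^{(k)}_max`: the largest reward gap between `πg` and a policy in `Π_k`. -/
noncomputable def deltaMax [∀ i, NeZero (d i)] (K : ℕ) (πg : Policy d) (k : ℕ) : ℝ :=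
  sSup ((fun π => expectedReward K πg - expectedReward K π) '' policiesAgreeing K πg k)

/-- `i` is a minimizer of `μ_j U_{j,k}` over all communities `j`. -/
def IsArgmin [∀ i, NeZero (d i)] (K : ℕ) (πg : Policy d) (k : ℕ) (i : Fin m) : Prop :=
  ∀ j, mu d i * U K πg k i ≤ mu d j * U K πg k j

/-- `ε_{i,k}`, with `istar = i^*_k`. -/
noncomputable def eps [∀ i, NeZero (d i)] (K : ℕ) (πg : Policy d) (k : ℕ) (istar i : Fin m) :
    ℝ≥0∞ :=
  if i = istar then ⊤
  else ENNReal.ofReal ((mu d i * U K πg k i - mu d istar * U K πg k istar)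
    / ((U K πg k i : ℝ) + (U K πg k istar : ℝ)))

end CommunityExploration

/-!
Exploring a community other than the best one leaves the best one best, so exploring the best one
first never hurts: greedy policies are optimal. Along a greedy policy the vector of the numbers of
distinct members runs through a chain that does not depend on the realization, and its `k`-th link
is `(U_{i,k})_i`. A round of the algorithm thus loses nothing unless the policy of the round
deviates from the greedy one at some link `k`. Comparing the two indices at that link shows that
some `μ̂_i` is then off by at least some `ε_{i,k}`.

Given the past, each new member of `C_i` collides with the previous one with probability `μ_i`,
however the policy chooses the communities, so the exponential weights of Hoeffding's lemma form a
supermartingale in the single exploration steps. Every round but the first adds at least one pair to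
`T_i`, so `μ̂_i` is off by `ε` after `t + 1` rounds with probability at most `exp (-2 ε² t)` in each
direction. These probabilities have a bounded sum over `t`.
-/

namespace CommunityExploration

/-! ### Averages over finite types -/

lemma expect_fin_succ {α : Type*} [Fintype α] (n : ℕ) (F : (Fin (n + 1) → α) → ℝ) :
    𝔼 x, F x = 𝔼 x : Fin n → α, 𝔼 a, F (Fin.snoc (α := fun _ => α) x a) := by
  rw [← Fintype.expect_equiv (Fin.snocEquiv fun _ => α) (fun y => F (Fin.snoc y.2 y.1)) F
    fun _ => rfl, ← Finset.univ_product_univ, Finset.expect_product, Finset.expect_comm]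

lemma ofFn_snoc {α : Type*} {n : ℕ} (x : Fin n → α) (a : α) :
    List.ofFn (Fin.snoc (α := fun _ => α) x a) = List.ofFn x ++ [a] := by
  rw [List.ofFn_succ']
  simp

lemma expect_sum_take {α : Type*} [Fintype α] [Nonempty α] (F : List α → α → ℝ) (n : ℕ) :
    𝔼 x : Fin n → α, ∑ t : Fin n, F ((List.ofFn x).take t) (x t)
      = ∑ t ∈ Finset.range n, 𝔼 x : Fin t → α, 𝔼 a, F (List.ofFn x) a := by
  induction n with
  | zero => simp
  | succ n ih =>
    have htake (x : Fin n → α) (a : α) (t : Fin n) :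
        (List.ofFn x ++ [a]).take t = (List.ofFn x).take t :=
      List.take_append_of_le_length (by simp [t.2.le])
    rw [Finset.sum_range_succ, ← ih, expect_fin_succ]
    simp only [Fin.sum_univ_castSucc, ofFn_snoc, Fin.snoc_castSucc, Fin.snoc_last,
      Fin.val_castSucc, Fin.val_last, Finset.expect_add_distrib, htake, Fintype.expect_const]
    simp

lemma expect_exp_mul_sub_expect_le {α : Type*} [Fintype α] [Nonempty α] {f : α → ℝ} {a b : ℝ}
    (hf : ∀ x, f x ∈ Set.Icc a b) (l : ℝ) :
    𝔼 x, Real.exp (l * (f x - 𝔼 y, f y)) ≤ Real.exp (l ^ 2 * (b - a) ^ 2 / 8) := by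
  let _ : MeasurableSpace α := ⊤
  let P : Measure α := (PMF.uniformOfFintype α).toMeasure
  have integral_eq (g : α → ℝ) : ∫ x, g x ∂P = 𝔼 x, g x := by
    have hmeas : DiscreteMeasurableSpace α := ⟨fun _ => trivial⟩
    rw [PMF.integral_eq_sum, Fintype.expect_eq_sum_div_card, Finset.sum_div]
    simp [div_eq_inv_mul]
  have h := (ProbabilityTheory.hasSubgaussianMGF_of_mem_Icc (μ := P)
    (measurable_from_top (f := f)).aemeasurable (.of_forall hf)).mgf_le l
  simp only [ProbabilityTheory.mgf, integral_eq] at h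
  refine h.trans_eq (congrArg Real.exp ?_)
  simp [div_pow]
  ring

lemma sum_exp_neg_mul_le {x : ℝ} (hx : 0 < x) (n : ℕ) :
    ∑ t ∈ Finset.range n, Real.exp (-x * t) ≤ 1 + 1 / x := by
  have hq : Real.exp (-x) ≤ (1 + x)⁻¹ := by
    rw [Real.exp_neg]
    exact inv_anti₀ (by positivity) (by linarith [Real.add_one_le_exp x])
  have hx1 : 0 < 1 - (1 + x)⁻¹ := sub_pos.2 (inv_lt_one_of_one_lt₀ (by linarith))
  calc ∑ t ∈ Finset.range n, Real.exp (-x * t) = ∑ t ∈ Finset.range n, Real.exp (-x) ^ t :=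
        Finset.sum_congr rfl fun t _ => by rw [← Real.exp_nat_mul, mul_comm]
    _ ≤ ∑' t : ℕ, Real.exp (-x) ^ t :=
        (summable_geometric_of_lt_one (Real.exp_nonneg _) (by linarith)).sum_le_tsum _
          fun t _ => by positivity
    _ = (1 - Real.exp (-x))⁻¹ := tsum_geometric_of_lt_one (Real.exp_nonneg _) (by linarith)
    _ ≤ (1 - (1 + x)⁻¹)⁻¹ := inv_anti₀ hx1 (by linarith)
    _ = 1 + 1 / x := by
        have : 1 - (1 + x)⁻¹ = x / (1 + x) := by field_simp; ring
        rw [this, inv_div]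
        field_simp
        ring

variable {m : ℕ} {d : Fin m → ℕ} {K : ℕ}

/-! ### Exploration step by step -/

/-- The partial realization after meeting `v` in one more exploration of `C_i`. -/
def addMember (ψ : PartialRealization d) (i : Fin m) (v : Fin (d i)) : PartialRealization d :=
  Function.update ψ i (ψ i ++ [v])

/-- What has been observed after `s` steps of `π` under `φ`. -/
def trajectory (π : Policy d) (φ : Realization d K) (s : ℕ) : PartialRealization d :=
  observed φ (explored π φ s)

lemma addMember_apply_self (ψ : PartialRealization d) (i : Fin m) (v : Fin (d i)) :
    addMember ψ i v i = ψ i ++ [v] :=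
  Function.update_self ..

lemma addMember_apply_of_ne (ψ : PartialRealization d) {i j : Fin m} (h : j ≠ i) (v : Fin (d i)) :
    addMember ψ i v j = ψ j :=
  Function.update_of_ne h ..

lemma addMember_comm (ψ : PartialRealization d) {i j : Fin m} (h : i ≠ j) (v : Fin (d i))
    (w : Fin (d j)) : addMember (addMember ψ i v) j w = addMember (addMember ψ j w) i v := by
  simp only [addMember, Function.update_of_ne h, Function.update_of_ne h.symm,
    Function.update_comm h]

lemma sum_explored (π : Policy d) (φ : Realization d K) (s : ℕ) :
    ∑ i, explored π φ s i = s := by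
  induction s with
  | zero => simp [explored]
  | succ s ih => simp [explored, Finset.sum_add_distrib, ih]

lemma explored_le (π : Policy d) (φ : Realization d K) (s : ℕ) (i : Fin m) :
    explored π φ s i ≤ s :=
  (Finset.single_le_sum (fun _ _ => Nat.zero_le _) (Finset.mem_univ i)).trans_eq
    (sum_explored π φ s)

lemma explored_succ (π : Policy d) (φ : Realization d K) (s : ℕ) :
    explored π φ (s + 1) = explored π φ s + Pi.single (π (trajectory π φ s)) 1 := rfl

lemma explored_mono (π : Policy d) (φ : Realization d K) : Monotone (explored π φ) :=
  monotone_nat_of_le_succ fun _ => le_self_add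

lemma length_trajectory (π : Policy d) (φ : Realization d K) {s : ℕ} (hs : s ≤ K) (i : Fin m) :
    (trajectory π φ s i).length = explored π φ s i := by
  simp only [trajectory, observed, List.length_take, List.length_ofFn]
  exact min_eq_left ((explored_le π φ s i).trans hs)

lemma trajectory_zero (π : Policy d) (φ : Realization d K) :
    trajectory π φ 0 = fun _ => [] := by
  ext1 i; simp [trajectory, observed, explored]

lemma observed_add_single (φ : Realization d K) (k : Fin m → ℕ) (i : Fin m) (h : k i < K) :
    observed φ (k + Pi.single i 1) = addMember (observed φ k) i (φ i ⟨k i, h⟩) := by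
  ext1 j
  by_cases hj : j = i
  · subst hj
    simp [observed, addMember_apply_self, List.take_add_one, h]
  · simp [observed, addMember_apply_of_ne _ hj, hj]

/-- The item `(i, τ)` that `π` explores in its step `s + 1` under `φ`. -/
def nextItem (π : Policy d) (φ : Realization d K) {s : ℕ} (hs : s < K) : Fin m × Fin K :=
  (π (trajectory π φ s), ⟨explored π φ s (π (trajectory π φ s)), (explored_le π φ s _).trans_lt hs⟩)

lemma trajectory_succ (π : Policy d) (φ : Realization d K) {s : ℕ} (hs : s < K) :
    trajectory π φ (s + 1) = addMember (trajectory π φ s) (nextItem π φ hs).1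
      (φ (nextItem π φ hs).1 (nextItem π φ hs).2) :=
  observed_add_single φ _ _ _

/-! ### The law of the observations -/

/-- `φ` with the member met at the item `p` replaced by `v`. -/
def resample (φ : Realization d K) (p : Fin m × Fin K) (v : Fin (d p.1)) : Realization d K :=
  Function.update φ p.1 (Function.update (φ p.1) p.2 v)

lemma resample_apply_self (φ : Realization d K) (p : Fin m × Fin K) (v : Fin (d p.1)) :
    resample φ p v p.1 p.2 = v := by simp [resample]

lemma resample_resample (φ : Realization d K) (p : Fin m × Fin K) (v w : Fin (d p.1)) :
    resample (resample φ p v) p w = resample φ p w := by simp [resample]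

lemma resample_eq_self (φ : Realization d K) (p : Fin m × Fin K) :
    resample φ p (φ p.1 p.2) = φ := by simp [resample]

lemma expect_resample [∀ i, NeZero (d i)] (p : Fin m × Fin K) (G : Realization d K → ℝ) :
    𝔼 φ, 𝔼 v, G (resample φ p v) = 𝔼 φ, G φ := by
  let e : Realization d K × Fin (d p.1) → Realization d K × Fin (d p.1) :=
    fun x => (resample x.1 p x.2, x.1 p.1 p.2)
  have he : Function.Involutive e := fun x => by
    simp only [e, resample_apply_self, resample_resample, resample_eq_self]
  have h : 𝔼 x : Realization d K × Fin (d p.1), G (resample x.1 p x.2)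
      = 𝔼 x : Realization d K × Fin (d p.1), G x.1 :=
    Fintype.expect_bijective e he.bijective _ _ fun _ => rfl
  rw [← Finset.univ_product_univ, Finset.expect_product, Finset.expect_product] at h
  simpa only [Fintype.expect_const] using h

/-- Independence and uniformity of the members: `p` picks an item without looking at the member that
is met there. -/
lemma expect_resample_of_adapted [∀ i, NeZero (d i)] {p : Realization d K → Fin m × Fin K}
    (hp : ∀ φ q v, p φ = q → p (resample φ q v) = q) (G : Realization d K → ℝ) :
    𝔼 φ, 𝔼 v, G (resample φ (p φ) v) = 𝔼 φ, G φ := by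
  have hp_iff (φ q v) : p (resample φ q v) = q ↔ p φ = q :=
    ⟨fun h => by simpa only [resample_resample, resample_eq_self] using hp _ q (φ q.1 q.2) h,
      hp φ q v⟩
  calc 𝔼 φ, 𝔼 v, G (resample φ (p φ) v)
      = 𝔼 φ, ∑ q, if p φ = q then 𝔼 v, G (resample φ q v) else 0 := by simp
    _ = ∑ q, 𝔼 φ, 𝔼 v, if p (resample φ q v) = q then G (resample φ q v) else 0 := by
        rw [Finset.expect_sum_comm]
        refine Finset.sum_congr rfl fun q _ => Finset.expect_congr rfl fun φ _ => ?_
        simp only [hp_iff]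
        split_ifs <;> simp
    _ = ∑ q, 𝔼 φ, if p φ = q then G φ else 0 :=
        Finset.sum_congr rfl fun q _ => expect_resample q fun φ => if p φ = q then G φ else 0
    _ = 𝔼 φ, G φ := by simp [← Finset.expect_sum_comm]

lemma observed_resample (φ : Realization d K) (p : Fin m × Fin K) (v : Fin (d p.1))
    {k : Fin m → ℕ} (hk : k p.1 ≤ p.2) : observed (resample φ p v) k = observed φ k := by
  ext1 i
  by_cases hi : i = p.1
  · subst hi
    refine List.ext_getElem (by simp [observed]) fun τ hτ _ => ?_
    have hτk : τ < k p.1 := by simp [observed] at hτ; omega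
    have hne : (⟨τ, by omega⟩ : Fin K) ≠ p.2 := Fin.ne_of_lt (hτk.trans_le hk)
    simp [observed, resample, Function.update_of_ne hne]
  · simp [observed, resample, hi]

lemma explored_resample (π : Policy d) (φ : Realization d K) (p : Fin m × Fin K)
    (v : Fin (d p.1)) {s : ℕ} (h : explored π φ s p.1 ≤ p.2) :
    explored π (resample φ p v) s = explored π φ s := by
  induction s with
  | zero => rfl
  | succ s ih =>
    have h' : explored π φ s p.1 ≤ p.2 := (explored_mono π φ s.le_succ p.1).trans h
    rw [explored_succ, explored_succ, trajectory, ih h', observed_resample _ _ _ h', trajectory]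

lemma trajectory_resample (π : Policy d) (φ : Realization d K) (p : Fin m × Fin K)
    (v : Fin (d p.1)) {s : ℕ} (h : explored π φ s p.1 ≤ p.2) :
    trajectory π (resample φ p v) s = trajectory π φ s := by
  rw [trajectory, explored_resample π φ p v h, observed_resample φ p v h, trajectory]

/-- The mean of `f` after one step of `π`. -/
noncomputable def stepMean (π : Policy d) (f : PartialRealization d → ℝ)
    (ψ : PartialRealization d) : ℝ :=
  𝔼 v : Fin (d (π ψ)), f (addMember ψ (π ψ) v)

lemma expect_trajectory_succ [∀ i, NeZero (d i)] (π : Policy d) (f : PartialRealization d → ℝ)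
    {s : ℕ} (hs : s < K) :
    𝔼 φ : Realization d K, f (trajectory π φ (s + 1))
      = 𝔼 φ : Realization d K, stepMean π f (trajectory π φ s) := by
  have htraj (φ : Realization d K) (v) :
      trajectory π (resample φ (nextItem π φ hs) v) s = trajectory π φ s :=
    trajectory_resample π φ _ v le_rfl
  have hnext (φ : Realization d K) (v) :
      nextItem π (resample φ (nextItem π φ hs) v) hs = nextItem π φ hs := by
    refine Prod.ext (congrArg π (htraj φ v)) (Fin.ext ?_)
    change explored π (resample φ (nextItem π φ hs) v) s (π (trajectory π _ s)) = _
    rw [htraj, explored_resample π φ _ v le_rfl]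
    rfl
  rw [← expect_resample_of_adapted (p := (nextItem π · hs)) (by rintro φ _ v rfl; exact hnext φ v)]
  refine Finset.expect_congr rfl fun φ _ => Finset.expect_congr rfl fun v _ => ?_
  rw [trajectory_succ π _ hs, htraj, hnext, resample_apply_self]
  rfl

lemma expect_trajectory [∀ i, NeZero (d i)] (π : Policy d) (f : PartialRealization d → ℝ)
    {s : ℕ} (hs : s ≤ K) :
    𝔼 φ : Realization d K, f (trajectory π φ s) = (stepMean π)^[s] f (fun _ => []) := by
  induction s generalizing f with
  | zero => simp [trajectory_zero]
  | succ s ih =>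
    rw [expect_trajectory_succ π f hs, ih _ (Nat.le_of_succ_le hs), Function.iterate_succ_apply]

lemma stepMean_mono (π : Policy d) : Monotone (stepMean π) :=
  fun _ _ h _ => Finset.expect_le_expect fun _ _ => h _

lemma iterate_stepMean_le (π : Policy d) {f : PartialRealization d → ℝ} (h : stepMean π f ≤ f)
    (n : ℕ) : (stepMean π)^[n] f ≤ f :=
  (stepMean_mono π).antitone_iterate_of_map_le h n.zero_le

/-! ### Optimality of greedy policies -/

/-- The number of distinct members met, as a real number: the reward of a partial realization. -/
def totalMet (ψ : PartialRealization d) : ℝ := ∑ i, (met ψ i : ℝ)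

lemma expectedReward_eq_iterate_stepMean [∀ i, NeZero (d i)] (K : ℕ) (π : Policy d) :
    expectedReward K π = (stepMean π)^[K] totalMet (fun _ => []) :=
  expect_trajectory π totalMet le_rfl

lemma met_addMember (ψ : PartialRealization d) (i : Fin m) (v : Fin (d i)) :
    met (addMember ψ i v) = met ψ + Pi.single i (if v ∈ ψ i then 0 else 1) := by
  ext j
  by_cases hj : j = i
  · subst hj
    have : (ψ j ++ [v]).toFinset = insert v (ψ j).toFinset := by ext; simp
    simp only [met, addMember_apply_self, this, Finset.card_insert_eq_ite, List.mem_toFinset,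
      Pi.add_apply, Pi.single_eq_same]
    split_ifs <;> rfl
  · simp [met, addMember_apply_of_ne _ hj, hj]

lemma met_le_met_addMember (ψ : PartialRealization d) (i : Fin m) (v : Fin (d i)) :
    met ψ ≤ met (addMember ψ i v) := by
  rw [met_addMember]; exact le_self_add

lemma met_le (ψ : PartialRealization d) (i : Fin m) : met ψ i ≤ d i := by
  simpa [met] using Finset.card_le_univ (ψ i).toFinset

lemma mu_nonneg (d : Fin m → ℕ) (i : Fin m) : 0 ≤ mu d i :=
  one_div_nonneg.2 (Nat.cast_nonneg _)

lemma expect_mem_eq (ψ : PartialRealization d) (i : Fin m) :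
    𝔼 v : Fin (d i), (if v ∈ ψ i then (1 : ℝ) else 0) = mu d i * met ψ i := by
  have : Finset.univ.filter (· ∈ ψ i) = (ψ i).toFinset := by ext; simp
  rw [Fintype.expect_eq_sum_div_card, Finset.sum_boole, this, mu, met, Fintype.card_fin]
  ring

lemma expect_totalMet_addMember [∀ i, NeZero (d i)] (ψ : PartialRealization d) (i : Fin m) :
    𝔼 v, totalMet (addMember ψ i v) = totalMet ψ + (1 - mu d i * met ψ i) := by
  have h (v) : totalMet (addMember ψ i v) = totalMet ψ + (1 - if v ∈ ψ i then (1 : ℝ) else 0) := by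
    simp only [totalMet, met_addMember, Pi.add_apply, Nat.cast_add, Finset.sum_add_distrib]
    rw [← Nat.cast_sum _ (Pi.single i _), Finset.sum_pi_single', if_pos (Finset.mem_univ i)]
    split_ifs <;> simp
  simp_rw [h]
  rw [Finset.expect_add_distrib, Finset.expect_sub_distrib, expect_mem_eq, Fintype.expect_const,
    Fintype.expect_const]

/-- The largest mean number of distinct members met after `n` more steps. -/
noncomputable def optValue : ℕ → PartialRealization d → ℝ
  | 0, ψ => totalMet ψ
  | n + 1, ψ => ⨆ i, 𝔼 v : Fin (d i), optValue n (addMember ψ i v)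

lemma expect_optValue_le (n : ℕ) (ψ : PartialRealization d) (i : Fin m) :
    𝔼 v : Fin (d i), optValue n (addMember ψ i v) ≤ optValue (n + 1) ψ :=
  le_ciSup (f := fun i => 𝔼 v : Fin (d i), optValue n (addMember ψ i v))
    (Set.finite_range _).bddAbove i

/-- `C_g` maximizes the probability of meeting a new member. -/
def IsBest (ψ : PartialRealization d) (g : Fin m) : Prop :=
  ∀ j, mu d g * met ψ g ≤ mu d j * met ψ j

lemma IsBest.addMember_of_ne {ψ : PartialRealization d} {g i : Fin m} (h : IsBest ψ g)
    (hi : g ≠ i) (v : Fin (d i)) : IsBest (addMember ψ i v) g := fun j => by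
  have hg : met (addMember ψ i v) g = met ψ g := by simp [met_addMember, hi]
  rw [hg]
  refine (h j).trans (mul_le_mul_of_nonneg_left ?_ (mu_nonneg d j))
  exact_mod_cast met_le_met_addMember ψ i v j

/-- The exchange argument: exploring `C_i` leaves a best community `C_g ≠ C_i` best, so `C_g` may as
well be explored first. -/
lemma expect_optValue_le_of_isBest [∀ i, NeZero (d i)] (n : ℕ) {ψ : PartialRealization d}
    {g : Fin m} (hg : IsBest ψ g) (i : Fin m) :
    𝔼 v, optValue n (addMember ψ i v) ≤ 𝔼 v, optValue n (addMember ψ g v) := by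
  induction n generalizing ψ g i with
  | zero =>
    simp only [optValue, expect_totalMet_addMember]
    linarith [hg i]
  | succ n ih =>
    obtain rfl | hi := eq_or_ne g i
    · rfl
    have : Nonempty (Fin m) := ⟨g⟩
    calc 𝔼 v, optValue (n + 1) (addMember ψ i v)
        ≤ 𝔼 v, 𝔼 w, optValue n (addMember (addMember ψ i v) g w) :=
          Finset.expect_le_expect fun v _ => ciSup_le fun j => ih (hg.addMember_of_ne hi v) j
      _ = 𝔼 w, 𝔼 v, optValue n (addMember (addMember ψ g w) i v) := by
          rw [Finset.expect_comm]
          simp_rw [addMember_comm ψ hi.symm]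
      _ ≤ _ := Finset.expect_le_expect fun w _ => expect_optValue_le _ _ _

lemma iterate_stepMean_totalMet_le (π : Policy d) (n : ℕ) :
    (stepMean π)^[n] totalMet ≤ optValue n := by
  induction n with
  | zero => exact le_rfl
  | succ n ih =>
    rw [Function.iterate_succ_apply']
    exact (stepMean_mono π ih).trans fun ψ => expect_optValue_le n ψ (π ψ)

lemma iterate_stepMean_totalMet_eq [∀ i, NeZero (d i)] {π : Policy d}
    (hπ : ∀ ψ, IsBest ψ (π ψ)) (n : ℕ) : (stepMean π)^[n] totalMet = optValue n := by
  induction n with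
  | zero => rfl
  | succ n ih =>
    rw [Function.iterate_succ_apply', ih]
    ext ψ
    have : Nonempty (Fin m) := ⟨π ψ⟩
    exact le_antisymm (expect_optValue_le n ψ (π ψ))
      (ciSup_le fun j => expect_optValue_le_of_isBest n (hπ ψ) j)

lemma isOptimal_of_isBest [∀ i, NeZero (d i)] (K : ℕ) {π : Policy d}
    (hπ : ∀ ψ, IsBest ψ (π ψ)) : IsOptimal K π := fun π' => by
  rw [expectedReward_eq_iterate_stepMean, expectedReward_eq_iterate_stepMean,
    iterate_stepMean_totalMet_eq hπ]
  exact iterate_stepMean_totalMet_le π' K _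

lemma IsGreedy.isBest {π : Policy d} (h : IsGreedy π) (ψ : PartialRealization d) :
    IsBest ψ (π ψ) := fun j => by linarith [h.1 ψ j]

/-! ### The exponential supermartingale of the collisions -/

lemma countP_zip_tail_concat {α : Type*} (p : α × α → Bool) {l : List α} (hl : l ≠ []) (x : α) :
    ((l ++ [x]).zip (l ++ [x]).tail).countP p
      = (l.zip l.tail).countP p + (p (l.getLast hl, x)).toNat := by
  induction l with
  | nil => exact absurd rfl hl
  | cons a l ih =>
    cases l with
    | nil => cases hp : p (a, x) <;> simp [hp]
    | cons b l =>
      have := ih (by simp)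
      simp only [List.cons_append, List.tail_cons, List.zip_cons_cons, List.countP_cons,
        List.getLast_cons_cons] at this ⊢
      omega

namespace PairStats

variable {n : ℕ}

lemma update_concat_collisions (s : PairStats n) (S : List (Fin n)) (v : Fin n) :
    (s.update (S ++ [v])).collisions
      = (s.update S).collisions + if (s.update S).last = some v then 1 else 0 := by
  have := countP_zip_tail_concat (fun p : Option (Fin n) × Option (Fin n) => decide (p.1 = p.2))
    (List.cons_ne_nil s.last (S.map some)) (some v)
  simp only [update, List.map_append, List.map_cons, List.map_nil, add_assoc]
  simp only [List.cons_append] at this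
  rw [this]
  congr 2
  split_ifs with h <;> simp [h]

lemma update_concat_pairs (s : PairStats n) (S : List (Fin n)) (v : Fin n)
    (h : s.rounds ≠ 0 ∨ S ≠ []) : (s.update (S ++ [v])).pairs = (s.update S).pairs + 1 := by
  simp only [update, List.length_append, List.length_singleton]
  rcases h with h | h
  · simp [h, add_assoc]
  · have := List.length_pos_iff.2 h
    split_ifs <;> omega

lemma update_last_ne_none (s : PairStats n) {S : List (Fin n)} (hS : S ≠ []) :
    (s.update S).last ≠ none := by
  simp only [update]
  rw [List.getLast_cons (by simpa using hS), List.getLast_map]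
  simp

/-- The statistics are consistent: there is a last member unless no round has been completed, and
each completed round but the first has contributed a pair. -/
structure Valid (s : PairStats n) : Prop where
  last_eq_none_iff : s.last = none ↔ s.rounds = 0
  rounds_le : s.rounds ≤ s.pairs + 1

lemma valid_init : (init n).Valid := ⟨by simp [init], by simp [init]⟩

lemma Valid.update {s : PairStats n} (hs : s.Valid) {S : List (Fin n)} (hS : S ≠ []) :
    (s.update S).Valid where
  last_eq_none_iff := iff_of_false (s.update_last_ne_none hS) (Nat.succ_ne_zero _)
  rounds_le := by
    have := List.length_pos_iff.2 hS
    have := hs.rounds_le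
    simp only [PairStats.update]
    split_ifs <;> omega

lemma Valid.exists_last_update_eq {s : PairStats n} (hs : s.Valid) {S : List (Fin n)}
    (h : s.rounds ≠ 0 ∨ S ≠ []) : ∃ u, (s.update S).last = some u := by
  refine Option.ne_none_iff_exists'.1 ?_
  by_cases hS : S = []
  · simpa [hS, PairStats.update, hs.last_eq_none_iff] using h
  · exact update_last_ne_none s hS

/-- The exponential weight of the deviation of the number of collisions from its mean `μ` per pair,
with the variance proxy `1 / 4` of an indicator. -/
noncomputable def expWeight (μ l : ℝ) (s : PairStats n) : ℝ :=
  Real.exp (l * s.collisions - (l * μ + l ^ 2 / 8) * s.pairs)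

lemma expWeight_nonneg (μ l : ℝ) (s : PairStats n) : 0 ≤ expWeight μ l s := Real.exp_nonneg _

lemma expWeight_update_nil (μ l : ℝ) (s : PairStats n) :
    expWeight μ l (s.update []) = expWeight μ l s := by
  simp [expWeight, update]

lemma expWeight_update_concat (μ l : ℝ) (s : PairStats n) {S : List (Fin n)}
    (h : s.rounds ≠ 0 ∨ S ≠ []) {u : Fin n} (hu : (s.update S).last = some u) (v : Fin n) :
    expWeight μ l (s.update (S ++ [v])) = expWeight μ l (s.update S) *
      (Real.exp (-(l ^ 2 / 8)) * Real.exp (l * ((if u = v then 1 else 0) - μ))) := by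
  rw [expWeight, expWeight, update_concat_collisions, update_concat_pairs s _ v h, hu,
    ← Real.exp_add, ← Real.exp_add]
  congr 1
  simp only [Option.some.injEq]
  push_cast
  ring

lemma Valid.expWeight_update_singleton {s : PairStats n} (hs : s.Valid) (h : s.rounds = 0)
    (μ l : ℝ) (v : Fin n) : expWeight μ l (s.update [v]) = expWeight μ l s := by
  have hlast := hs.last_eq_none_iff.2 h
  simp [expWeight, PairStats.update, h, hlast]

/-- Chernoff's choice `l = ± 4 ε` of the parameter. -/
lemma exp_le_expWeight {s : PairStats n} (hs : 0 < s.pairs) {μ σ ε : ℝ} (hσ : σ ^ 2 = 1)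
    (hε : 0 ≤ ε) (h : ε ≤ σ * (s.collisions / s.pairs - μ)) :
    Real.exp (2 * ε ^ 2 * s.pairs) ≤ expWeight μ (4 * ε * σ) s := by
  have : (0 : ℝ) < s.pairs := Nat.cast_pos.2 hs
  have hdev : ε * s.pairs ≤ σ * (s.collisions - μ * s.pairs) := by
    calc ε * s.pairs ≤ σ * (s.collisions / s.pairs - μ) * s.pairs := by gcongr
      _ = _ := by field_simp
  have hmul := mul_le_mul_of_nonneg_left hdev (by positivity : 0 ≤ 4 * ε)
  refine Real.exp_le_exp.2 ?_
  linear_combination hmul + 2 * ε ^ 2 * s.pairs * hσ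

end PairStats

open PairStats

lemma expect_eq_mu (i : Fin m) (u : Fin (d i)) :
    𝔼 v : Fin (d i), (if u = v then (1 : ℝ) else 0) = mu d i := by
  simp [mu]

lemma expect_expWeight_factor_le_one [∀ i, NeZero (d i)] (i : Fin m) (u : Fin (d i)) (l : ℝ) :
    𝔼 v, Real.exp (-(l ^ 2 / 8)) * Real.exp (l * ((if u = v then 1 else 0) - mu d i)) ≤ 1 := by
  have hoeffding := expect_exp_mul_sub_expect_le (a := 0) (b := 1)
    (f := fun v : Fin (d i) => if u = v then 1 else 0) (fun v => by split_ifs <;> simp) l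
  rw [expect_eq_mu] at hoeffding
  rw [← Finset.mul_expect, Real.exp_neg, inv_mul_le_one₀ (Real.exp_pos _)]
  simpa using hoeffding

/-- The exploration of one more member multiplies the weight by a factor of mean at most `1`,
except that the very first member does not complete a pair. -/
lemma stepMean_expWeight_le [∀ i, NeZero (d i)] (π : Policy d) (i : Fin m) (l : ℝ)
    {s : PairStats (d i)} (hs : s.Valid) :
    stepMean π (fun ψ => expWeight (mu d i) l (s.update (ψ i)))
      ≤ fun ψ => expWeight (mu d i) l (s.update (ψ i)) := by
  intro ψ
  unfold stepMean
  by_cases hi : i = π ψ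
  · subst hi
    simp only [addMember_apply_self]
    by_cases h : s.rounds ≠ 0 ∨ ψ (π ψ) ≠ []
    · obtain ⟨u, hu⟩ := hs.exists_last_update_eq h
      simp_rw [expWeight_update_concat _ l s h hu]
      rw [← Finset.mul_expect]
      exact mul_le_of_le_one_right (expWeight_nonneg _ _ _) (expect_expWeight_factor_le_one _ u l)
    · push Not at h
      simp [h.2, hs.expWeight_update_singleton h.1, expWeight_update_nil]
  · simp [addMember_apply_of_ne _ hi]

/-! ### Concentration of the empirical means -/

/-- An unexplored community is chosen as long as there is one. -/
def PrefersUnexplored (π : Policy d) : Prop :=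
  ∀ ψ : PartialRealization d, (∃ j, ψ j = []) → ψ (π ψ) = []

lemma exists_trajectory_eq_nil (π : Policy d) (φ : Realization d K) {s : ℕ} (hm : s < m)
    (hs : s ≤ K) : ∃ i, trajectory π φ s i = [] := by
  by_contra! h
  have : ∑ _i : Fin m, 1 ≤ ∑ i, explored π φ s i := Finset.sum_le_sum fun i _ => by
    rw [← length_trajectory π φ hs i]
    exact List.length_pos_iff.2 (h i)
  simp [sum_explored] at this
  omega

lemma PrefersUnexplored.explored_le_one {π : Policy d} (h : PrefersUnexplored π)
    (φ : Realization d K) {s : ℕ} (hm : s ≤ m) (hs : s ≤ K) : explored π φ s ≤ 1 := by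
  induction s with
  | zero => exact fun _ => zero_le_one
  | succ s ih =>
    have hnil := congrArg List.length (h _ (exists_trajectory_eq_nil π φ hm (Nat.le_of_succ_le hs)))
    rw [length_trajectory π φ (Nat.le_of_succ_le hs), List.length_nil] at hnil
    intro i
    rw [explored_succ, Pi.add_apply]
    by_cases hi : i = π (trajectory π φ s)
    · simp [hi, hnil]
    · simpa [hi] using ih (Nat.le_of_succ_le hm) (Nat.le_of_succ_le hs) i

lemma PrefersUnexplored.explored_eq_one {π : Policy d} (h : PrefersUnexplored π)
    (φ : Realization d K) (hK : m ≤ K) : explored π φ m = 1 := by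
  have hsum : ∑ i, explored π φ m i = ∑ _i : Fin m, 1 := by simp [sum_explored]
  ext i
  exact (Finset.sum_eq_sum_iff_of_le fun i _ => h.explored_le_one φ le_rfl hK i).1 hsum i
    (Finset.mem_univ i)

lemma PrefersUnexplored.trajectory_ne_nil {π : Policy d} (h : PrefersUnexplored π)
    (φ : Realization d K) {s : ℕ} (hm : m ≤ s) (hs : s ≤ K) (i : Fin m) :
    trajectory π φ s i ≠ [] := by
  rw [← List.length_pos_iff, length_trajectory π φ hs]
  calc 0 < explored π φ m i := by simp [h.explored_eq_one φ (hm.trans hs)]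
    _ ≤ _ := explored_mono π φ hm i

lemma stats_concat (h : Feedback d) (ψ : PartialRealization d) (i : Fin m) :
    stats (h ++ [ψ]) i = (stats h i).update (ψ i) := by
  simp [stats]

lemma feedback_concat (A : Learner d) (φs : List (Realization d K)) (φ : Realization d K) :
    feedback A (φs ++ [φ]) = feedback A φs ++ [trajectory (A (feedback A φs)) φ K] := by
  simp [feedback, trajectory]

lemma rounds_stats_feedback (A : Learner d) (φs : List (Realization d K)) (i : Fin m) :
    (stats (feedback A φs) i).rounds = φs.length := by
  induction φs using List.reverseRecOn with
  | nil => rfl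
  | append_singleton φs φ ih => simp [feedback_concat, stats_concat, PairStats.update, ih]

lemma valid_stats_feedback {A : Learner d} (hA : ∀ h, PrefersUnexplored (A h)) (hK : m ≤ K)
    (φs : List (Realization d K)) (i : Fin m) : (stats (feedback A φs) i).Valid := by
  induction φs using List.reverseRecOn with
  | nil => exact valid_init
  | append_singleton φs φ ih =>
    rw [feedback_concat, stats_concat]
    exact ih.update ((hA _).trajectory_ne_nil φ hK le_rfl i)

/-- The mean of `F` over the feedback that `A` collects in `t` rounds with budget `K`. -/
noncomputable def feedbackMean (K : ℕ) (A : Learner d) (t : ℕ) (F : Feedback d → ℝ) : ℝ :=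
  𝔼 Φ : Fin t → Realization d K, F (feedback A (List.ofFn Φ))

/-- The probability that the feedback that `A` collects in `t` rounds with budget `K` lies in
`E`. -/
noncomputable def feedbackProb (K : ℕ) (A : Learner d) (t : ℕ) (E : Set (Feedback d)) : ℝ :=
  feedbackMean K A t (E.indicator 1)

lemma feedbackMean_mono {A : Learner d} {t : ℕ} {F G : Feedback d → ℝ}
    (h : ∀ φs : List (Realization d K), φs.length = t → F (feedback A φs) ≤ G (feedback A φs)) :
    feedbackMean K A t F ≤ feedbackMean K A t G :=
  Finset.expect_le_expect fun _ _ => h _ (List.length_ofFn ..)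

lemma feedbackMean_succ (A : Learner d) (t : ℕ) (F : Feedback d → ℝ) :
    feedbackMean K A (t + 1) F
      = feedbackMean K A t fun h => 𝔼 φ : Realization d K, F (h ++ [trajectory (A h) φ K]) := by
  simp only [feedbackMean, expect_fin_succ, ofFn_snoc, feedback_concat]

lemma feedbackProb_le_one [∀ i, NeZero (d i)] (A : Learner d) (t : ℕ) (E : Set (Feedback d)) :
    feedbackProb K A t E ≤ 1 :=
  Finset.expect_le Finset.univ_nonempty fun _ _ => Set.indicator_le_self' (by simp) _

lemma feedbackProb_le_sum {ι : Type*} (A : Learner d) (t : ℕ) {E : Set (Feedback d)}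
    {S : Finset ι} {F : ι → Set (Feedback d)} (hE : E ⊆ ⋃ i ∈ S, F i) :
    feedbackProb K A t E ≤ ∑ i ∈ S, feedbackProb K A t (F i) := by
  have hnonneg (h : Feedback d) (i : ι) : 0 ≤ (F i).indicator (1 : Feedback d → ℝ) h :=
    Set.indicator_nonneg (fun _ _ => zero_le_one) h
  simp only [feedbackProb, feedbackMean, ← Finset.expect_sum_comm]
  refine Finset.expect_le_expect fun Φ _ => Set.indicator_apply_le' (fun hΦ => ?_)
    fun _ => Finset.sum_nonneg fun i _ => hnonneg _ i
  obtain ⟨i, hi, hiΦ⟩ := Set.mem_iUnion₂.1 (hE hΦ)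
  exact (Set.indicator_of_mem hiΦ _).symm.trans_le
    (Finset.single_le_sum (fun i _ => hnonneg _ i) hi)

lemma feedbackMean_expWeight_le_one [∀ i, NeZero (d i)] {A : Learner d}
    (hA : ∀ h, PrefersUnexplored (A h)) (hK : m ≤ K) (i : Fin m) (l : ℝ) (t : ℕ) :
    feedbackMean K A t (fun h => expWeight (mu d i) l (stats h i)) ≤ 1 := by
  induction t with
  | zero => simp [feedbackMean, feedback, stats, PairStats.init, expWeight]
  | succ t ih =>
    rw [feedbackMean_succ]
    refine (feedbackMean_mono fun φs _ => ?_).trans ih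
    simp_rw [stats_concat]
    have hstep := stepMean_expWeight_le (A (feedback A φs)) i l (valid_stats_feedback hA hK φs i)
    rw [expect_trajectory (A (feedback A φs))
      (fun ψ => expWeight (mu d i) l ((stats (feedback A φs) i).update (ψ i))) le_rfl]
    exact (iterate_stepMean_le _ hstep K _).trans_eq (expWeight_update_nil ..)

/-- Every round but the first contributes a pair, so `t` pairs have been observed in `t + 1`
rounds. -/
lemma feedbackProb_deviation_le [∀ i, NeZero (d i)] {A : Learner d}
    (hA : ∀ h, PrefersUnexplored (A h)) (hK : m ≤ K) (i : Fin m) {σ ε : ℝ} (hσ : σ ^ 2 = 1)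
    (hε : 0 ≤ ε) (t : ℕ) :
    feedbackProb K A (t + 1) {h | ε ≤ σ * (muHat h i - mu d i)}
      ≤ Real.exp (-(2 * ε ^ 2) * t) := by
  obtain rfl | ht := Nat.eq_zero_or_pos t
  · simpa using feedbackProb_le_one A 1 _
  calc feedbackProb K A (t + 1) {h | ε ≤ σ * (muHat h i - mu d i)}
      ≤ feedbackMean K A (t + 1) fun h =>
          Real.exp (-(2 * ε ^ 2) * t) * expWeight (mu d i) (4 * ε * σ) (stats h i) := by
        refine feedbackMean_mono fun φs hφs => Set.indicator_apply_le' (fun h => ?_)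
          fun _ => mul_nonneg (Real.exp_nonneg _) (expWeight_nonneg _ _ _)
        have hpairs : t ≤ (stats (feedback A φs) i).pairs := by
          simpa [rounds_stats_feedback, hφs] using (valid_stats_feedback hA hK φs i).rounds_le
        rw [Pi.one_apply, neg_mul, Real.exp_neg, le_inv_mul_iff₀ (Real.exp_pos _), mul_one]
        refine le_trans ?_ (exp_le_expWeight (ht.trans_le hpairs) hσ hε h)
        gcongr
    _ = Real.exp (-(2 * ε ^ 2) * t) *
          feedbackMean K A (t + 1) fun h => expWeight (mu d i) (4 * ε * σ) (stats h i) :=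
        by simp only [feedbackMean, Finset.mul_expect]
    _ ≤ Real.exp (-(2 * ε ^ 2) * t) :=
        mul_le_of_le_one_right (Real.exp_nonneg _) (feedbackMean_expWeight_le_one hA hK i _ _)

lemma feedbackProb_succ_le_sum_exp [∀ i, NeZero (d i)] {ι : Type*} {A : Learner d}
    (hA : ∀ h, PrefersUnexplored (A h)) (hK : m ≤ K) {E : Set (Feedback d)} {S : Finset ι}
    {ε : ι → ℝ} (p q : ι → Fin m) (hε : ∀ i ∈ S, 0 < ε i)
    (hE : ∀ h ∈ E, ∃ i ∈ S, ε i ≤ muHat h (p i) - mu d (p i) ∨ ε i ≤ mu d (q i) - muHat h (q i))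
    (t : ℕ) : feedbackProb K A (t + 1) E ≤ ∑ i ∈ S, 2 * Real.exp (-(2 * ε i ^ 2) * t) := by
  let above (i : ι) : Set (Feedback d) := {h | ε i ≤ 1 * (muHat h (p i) - mu d (p i))}
  let below (i : ι) : Set (Feedback d) := {h | ε i ≤ -1 * (muHat h (q i) - mu d (q i))}
  have hcover : E ⊆ ⋃ x ∈ S.disjSum S, Sum.elim above below x := by
    intro h hh
    obtain ⟨i, hi, hdev | hdev⟩ := hE h hh
    · exact Set.mem_iUnion₂.2 ⟨.inl i, by simpa, by simpa [above] using hdev⟩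
    · exact Set.mem_iUnion₂.2 ⟨.inr i, by simpa, by simpa [below] using hdev⟩
  refine (feedbackProb_le_sum A (t + 1) hcover).trans ?_
  rw [Finset.sum_disjSum, ← Finset.sum_add_distrib]
  refine Finset.sum_le_sum fun i hi => ?_
  rw [two_mul]
  exact add_le_add (feedbackProb_deviation_le hA hK (p i) (by norm_num) (hε i hi).le t)
    (feedbackProb_deviation_le hA hK (q i) (by norm_num) (hε i hi).le t)

lemma sum_feedbackProb_le [∀ i, NeZero (d i)] {ι : Type*} {A : Learner d}
    (hA : ∀ h, PrefersUnexplored (A h)) (hK : m ≤ K) {E : Set (Feedback d)} {S : Finset ι}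
    {ε : ι → ℝ} (p q : ι → Fin m) (hε : ∀ i ∈ S, 0 < ε i)
    (hE : ∀ h ∈ E, ∃ i ∈ S, ε i ≤ muHat h (p i) - mu d (p i) ∨ ε i ≤ mu d (q i) - muHat h (q i))
    (T : ℕ) : ∑ t ∈ Finset.range T, feedbackProb K A t E ≤ 1 + ∑ i ∈ S, (2 + 1 / ε i ^ 2) := by
  cases T with
  | zero =>
    have : 0 ≤ ∑ i ∈ S, (2 + 1 / ε i ^ 2) := Finset.sum_nonneg fun i _ => by positivity
    simp only [Finset.range_zero, Finset.sum_empty]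
    linarith
  | succ T =>
    rw [Finset.sum_range_succ', add_comm]
    refine add_le_add (feedbackProb_le_one _ _ _) ?_
    calc ∑ t ∈ Finset.range T, feedbackProb K A (t + 1) E
        ≤ ∑ t ∈ Finset.range T, ∑ i ∈ S, 2 * Real.exp (-(2 * ε i ^ 2) * t) :=
          Finset.sum_le_sum fun t _ => feedbackProb_succ_le_sum_exp hA hK p q hε hE t
      _ = ∑ i ∈ S, 2 * ∑ t ∈ Finset.range T, Real.exp (-(2 * ε i ^ 2) * t) := by
          rw [Finset.sum_comm]
          simp only [Finset.mul_sum]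
      _ ≤ ∑ i ∈ S, 2 * (1 + 1 / (2 * ε i ^ 2)) := by
          gcongr with i hi
          exact sum_exp_neg_mul_le (by have := hε i hi; positivity) T
      _ = ∑ i ∈ S, (2 + 1 / ε i ^ 2) := Finset.sum_congr rfl fun i _ => by ring

/-! ### The greedy chain -/

/-- All members of all communities have been met. -/
def Full (ψ : PartialRealization d) : Prop := ∀ i, met ψ i = d i

lemma Full.addMember {ψ : PartialRealization d} (h : Full ψ) (i : Fin m) (v : Fin (d i)) :
    Full (addMember ψ i v) := fun j =>
  (met_le _ j).antisymm ((h j).ge.trans (met_le_met_addMember ψ i v j))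

lemma Full.totalMet_eq {ψ : PartialRealization d} (h : Full ψ) :
    totalMet ψ = ∑ i, (d i : ℝ) := by
  simp only [totalMet, h _]

lemma explored_eq_or_full {π π' : Policy d} (h : PrefersUnexplored π)
    (h' : PrefersUnexplored π') (φ : Realization d K)
    (hagree : ∀ s, m ≤ s → s < K →
      π (trajectory π' φ s) = π' (trajectory π' φ s) ∨ Full (trajectory π' φ s))
    {s : ℕ} (hm : m ≤ s) (hs : s ≤ K) :
    explored π φ s = explored π' φ s ∨ Full (trajectory π φ s) ∧ Full (trajectory π' φ s) := by
  induction s, hm using Nat.le_induction with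
  | base => exact .inl (by rw [h.explored_eq_one φ hs, h'.explored_eq_one φ hs])
  | succ s hm ih =>
    rw [trajectory_succ π φ hs, trajectory_succ π' φ hs]
    obtain heq | ⟨hfull, hfull'⟩ := ih (Nat.le_of_succ_le hs)
    · have htraj : trajectory π φ s = trajectory π' φ s := by rw [trajectory, heq, trajectory]
      obtain hchoice | hfull := hagree s hm hs
      · exact .inl (by rw [explored_succ, explored_succ, heq, htraj, hchoice])
      · exact .inr ⟨(htraj ▸ hfull).addMember _ _, hfull.addMember _ _⟩
    · exact .inr ⟨hfull.addMember _ _, hfull'.addMember _ _⟩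

lemma expectedReward_congr {π π' : Policy d} (h : PrefersUnexplored π)
    (h' : PrefersUnexplored π') (hK : m ≤ K)
    (hagree : ∀ (φ : Realization d K) s, m ≤ s → s < K →
      π (trajectory π' φ s) = π' (trajectory π' φ s) ∨ Full (trajectory π' φ s)) :
    expectedReward K π = expectedReward K π' := by
  refine Finset.expect_congr rfl fun φ _ => ?_
  obtain heq | ⟨hfull, hfull'⟩ := explored_eq_or_full h h' φ (hagree φ) hK le_rfl
  · rw [heq]
  · exact hfull.totalMet_eq.trans hfull'.totalMet_eq.symm

lemma expectedReward_nonneg (K : ℕ) (π : Policy d) : 0 ≤ expectedReward K π :=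
  Finset.expect_nonneg fun _ _ => Finset.sum_nonneg fun _ _ => Nat.cast_nonneg _

lemma met_eq_zero_iff {ψ : PartialRealization d} {i : Fin m} : met ψ i = 0 ↔ ψ i = [] := by
  simp [met]

lemma met_trajectory_zero (π : Policy d) (φ : Realization d K) : met (trajectory π φ 0) = 0 := by
  ext i
  simp [trajectory_zero, met_eq_zero_iff]

section Greedy

variable [∀ i, NeZero (d i)]

lemma mu_pos (d : Fin m → ℕ) [∀ i, NeZero (d i)] (i : Fin m) : 0 < mu d i :=
  one_div_pos.2 (by exact_mod_cast NeZero.pos (d i))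

lemma IsGreedy.prefersUnexplored {πg : Policy d} (hg : IsGreedy πg) : PrefersUnexplored πg := by
  rintro ψ ⟨j, hj⟩
  have h := hg.isBest ψ j
  rw [met_eq_zero_iff.2 hj, Nat.cast_zero, mul_zero] at h
  rw [← met_eq_zero_iff]
  exact_mod_cast (nonpos_of_mul_nonpos_right h (mu_pos _ _)).antisymm (Nat.cast_nonneg _)

lemma IsBest.full_of_met_eq {ψ : PartialRealization d} {g : Fin m} (h : IsBest ψ g)
    (hg : met ψ g = d g) : Full ψ := fun j => by
  refine (met_le ψ j).antisymm ?_
  have hj : (1 : ℝ) ≤ met ψ j / d j := by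
    simpa [mu, hg, NeZero.ne, inv_mul_eq_div] using h j
  rw [one_le_div (by exact_mod_cast NeZero.pos (d j))] at hj
  exact_mod_cast hj

lemma met_observed_distinctRealization {k : Fin m → ℕ} {i : Fin m} (hK : k i ≤ K)
    (hd : k i ≤ d i) : met (observed (distinctRealization d K) k) i = k i := by
  rw [met, List.toFinset_card_of_nodup]
  · simp [observed, hK]
  · refine List.nodup_iff_injective_getElem.2 fun a b hab => Fin.ext ?_
    have hlt (c : Fin (observed (distinctRealization d K) k i).length) : (c : ℕ) < k i :=
      c.2.trans_le (by simp [observed])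
    simpa [observed, distinctRealization, Fin.ext_iff, Nat.mod_eq_of_lt ((hlt _).trans_le hd)]
      using hab

lemma IsGreedy.explored_distinctRealization_le {πg : Policy d} (hg : IsGreedy πg) {s : ℕ}
    (hK : s ≤ K) (hD : s ≤ ∑ i, d i) : explored πg (distinctRealization d K) s ≤ d := by
  induction s with
  | zero => exact fun _ => Nat.zero_le _
  | succ s ih =>
    have ih := ih (Nat.le_of_succ_le hK) (Nat.le_of_succ_le hD)
    have hmet : met (trajectory πg (distinctRealization d K) s)
        = explored πg (distinctRealization d K) s := funext fun i =>
      met_observed_distinctRealization ((explored_le ..).trans (Nat.le_of_succ_le hK)) (ih i)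
    intro i
    obtain rfl | hi := eq_or_ne i (πg (trajectory πg (distinctRealization d K) s))
    · suffices hne : explored πg (distinctRealization d K) s _ ≠ d _ by
        simpa [explored_succ] using (ih _).lt_of_ne hne
      rw [← hmet]
      intro hmax
      have hfull := (hg.isBest _).full_of_met_eq hmax
      rw [Full, hmet] at hfull
      simp [← hfull, sum_explored] at hD
    · simpa [explored_succ, hi] using ih i

lemma U_one (K : ℕ) (πg : Policy d) : U K πg 1 = 0 := rfl

lemma sum_U (K : ℕ) (πg : Policy d) (k : ℕ) : ∑ i, U K πg k i = k - 1 :=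
  sum_explored ..

lemma IsGreedy.U_succ {πg : Policy d} (hg : IsGreedy πg) {k : ℕ} (h1 : 1 ≤ k)
    (hk : k ≤ min K (∑ i, d i)) {ψ : PartialRealization d} (hψ : met ψ = U K πg k) :
    U K πg (k + 1) = U K πg k + Pi.single (πg ψ) 1 := by
  obtain ⟨s, rfl⟩ := Nat.exists_eq_add_of_le' h1
  have hmet : met ψ = met (trajectory πg (distinctRealization d K) s) := by
    rw [hψ]
    ext i
    exact (met_observed_distinctRealization ((explored_le ..).trans (by omega))
      (hg.explored_distinctRealization_le (by omega) (by omega) i)).symm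
  rw [hg.2 _ _ hmet]
  rfl

lemma IsGreedy.met_addMember_eq_U {πg : Policy d} (hg : IsGreedy πg) {k : ℕ} (h1 : 1 ≤ k)
    (hk : k ≤ min K (∑ i, d i)) {ψ : PartialRealization d} (hψ : met ψ = U K πg k) {i : Fin m}
    (hi : i = πg ψ) (v : Fin (d i)) :
    met (addMember ψ i v) = U K πg k ∨ met (addMember ψ i v) = U K πg (k + 1) := by
  rw [met_addMember, hg.U_succ h1 hk hψ, hψ]
  subst hi
  split_ifs <;> simp

lemma IsGreedy.full_of_met_eq_U {πg : Policy d} (hg : IsGreedy πg) (hD : ∑ i, d i ≤ K)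
    {ψ : PartialRealization d} (hψ : met ψ = U K πg (∑ i, d i + 1)) : Full ψ := fun i => by
  rw [hψ]
  have hsum : ∑ i, U K πg (∑ i, d i + 1) i = ∑ i, d i := sum_U ..
  exact (Finset.sum_eq_sum_iff_of_le fun i _ =>
    hg.explored_distinctRealization_le hD le_rfl i).1 hsum i (Finset.mem_univ i)

lemma IsGreedy.exists_met_eq_U_of_mem_policiesAgreeing {πg π : Policy d} (hg : IsGreedy πg)
    {k₀ : ℕ} (h0 : 1 ≤ k₀) (hk₀ : k₀ ≤ min K (∑ i, d i)) (hπ : π ∈ policiesAgreeing K πg k₀)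
    (φ : Realization d K) {s : ℕ} (hs : s ≤ K) (hlt : met (trajectory π φ s) < U K πg k₀) :
    ∃ k, 1 ≤ k ∧ k < k₀ ∧ met (trajectory π φ s) = U K πg k := by
  induction s with
  | zero =>
    rw [met_trajectory_zero] at hlt ⊢
    exact ⟨1, le_rfl, h0.lt_of_ne (by rintro rfl; exact hlt.ne (U_one K πg).symm), rfl⟩
  | succ s ih =>
    rw [trajectory_succ π φ hs] at hlt ⊢
    have hlt' : met (trajectory π φ s) < U K πg k₀ :=
      (met_le_met_addMember _ _ _).trans_lt hlt
    obtain ⟨k, h1, hk, hmet⟩ := ih (Nat.le_of_succ_le hs) hlt'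
    have hchoice : π (trajectory π φ s) = πg (trajectory π φ s) :=
      hπ _ hlt'.le (Pi.lt_def.1 hlt').2
    obtain hnext | hnext := hg.met_addMember_eq_U h1 (hk.le.trans hk₀) hmet hchoice
      (φ _ (nextItem π φ hs).2)
    · exact ⟨k, h1, hk, hnext⟩
    · exact ⟨k + 1, by omega, lt_of_le_of_ne hk (by rintro rfl; exact hlt.ne hnext), hnext⟩

lemma IsGreedy.exists_met_trajectory_eq_U {πg : Policy d} (hg : IsGreedy πg)
    (φ : Realization d K) {s : ℕ} (hs : s ≤ K) :
    ∃ k, 1 ≤ k ∧ k ≤ min s (∑ i, d i) + 1 ∧ met (trajectory πg φ s) = U K πg k := by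
  induction s with
  | zero => exact ⟨1, le_rfl, by simp, met_trajectory_zero πg φ⟩
  | succ s ih =>
    obtain ⟨k, h1, hk, hmet⟩ := ih (Nat.le_of_succ_le hs)
    rw [trajectory_succ πg φ hs]
    obtain hkD | rfl : k ≤ ∑ i, d i ∨ k = ∑ i, d i + 1 := by omega
    · obtain hnext | hnext := hg.met_addMember_eq_U h1 (by omega) hmet rfl
        (φ _ (nextItem πg φ hs).2)
      · exact ⟨k, h1, by omega, hnext⟩
      · exact ⟨k + 1, by omega, by omega, hnext⟩
    · have hfull := hg.full_of_met_eq_U (by omega) hmet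
      refine ⟨_, h1, by omega, hmet.symm ▸ ?_⟩
      ext i
      rw [hfull.addMember _ _ i, hfull i]

/-! ### The loss of a policy that leaves the greedy chain -/

/-- `π` differs from `πg` at some partial realization with `U_{i,k}` distinct members met in each
`C_i`: it leaves the greedy chain at its `k`-th link. -/
def Deviates (K : ℕ) (πg π : Policy d) (k : ℕ) : Prop :=
  ∃ ψ, met ψ = U K πg k ∧ π ψ ≠ πg ψ

lemma PrefersUnexplored.succ_le_of_met_eq_U {πg π : Policy d} (h : PrefersUnexplored π)
    (φ : Realization d K) {s k : ℕ} (hm : m ≤ s) (hs : s ≤ K) (h1 : 1 ≤ k)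
    (hk : met (trajectory π φ s) = U K πg k) : m + 1 ≤ k := by
  have hpos : ∑ _i : Fin m, 1 ≤ ∑ i, U K πg k i := Finset.sum_le_sum fun i _ => by
    rw [← hk, Nat.one_le_iff_ne_zero, Ne, met_eq_zero_iff]
    exact h.trajectory_ne_nil φ hm hs i
  simp only [sum_U, Finset.sum_const, Finset.card_univ, Fintype.card_fin, smul_eq_mul] at hpos
  omega

lemma IsGreedy.expectedReward_eq_of_not_deviates {πg π : Policy d} (hg : IsGreedy πg)
    (h : PrefersUnexplored π) (hK : m ≤ K)
    (hdev : ∀ k ∈ Finset.Icc (m + 1) (min K (∑ i, d i)), ¬ Deviates K πg π k) :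
    expectedReward K π = expectedReward K πg := by
  refine expectedReward_congr h hg.prefersUnexplored hK fun φ s hm hs => ?_
  obtain ⟨k, h1, hk, hmet⟩ := hg.exists_met_trajectory_eq_U φ hs.le
  obtain hkD | rfl : k ≤ ∑ i, d i ∨ k = ∑ i, d i + 1 := by omega
  · have hmk := hg.prefersUnexplored.succ_le_of_met_eq_U φ hm hs.le h1 hmet
    refine .inl (by_contra fun hne => hdev k ?_ ⟨_, hmet, hne⟩)
    exact Finset.mem_Icc.2 ⟨hmk, by omega⟩
  · exact .inr (hg.full_of_met_eq_U (by omega) hmet)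

open Classical in
/-- Replacing the choices of `π` by those of `πg` before the `k₀`-th link of the greedy chain does
not change what is explored. -/
lemma IsGreedy.exists_mem_policiesAgreeing {πg π : Policy d} (hg : IsGreedy πg)
    (h : PrefersUnexplored π) (hK : m ≤ K) {k₀ : ℕ} (h0 : 1 ≤ k₀) (hk₀ : k₀ ≤ min K (∑ i, d i))
    (hdev : ∀ k, m + 1 ≤ k → k < k₀ → ¬ Deviates K πg π k) :
    ∃ π' ∈ policiesAgreeing K πg k₀, expectedReward K π = expectedReward K π' := by
  let π' : Policy d := fun ψ => if met ψ < U K πg k₀ then πg ψ else π ψ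
  have hmem : π' ∈ policiesAgreeing K πg k₀ := fun ψ hle hlt => if_pos (Pi.lt_def.2 ⟨hle, hlt⟩)
  have h' : PrefersUnexplored π' := fun ψ hψ => by
    by_cases hlt : met ψ < U K πg k₀
    · rw [show π' ψ = πg ψ from if_pos hlt]
      exact hg.prefersUnexplored ψ hψ
    · rw [show π' ψ = π ψ from if_neg hlt]
      exact h ψ hψ
  refine ⟨π', hmem, expectedReward_congr h h' hK fun φ s hm hs => .inl ?_⟩
  by_cases hlt : met (trajectory π' φ s) < U K πg k₀
  · obtain ⟨k, h1, hk, hmet⟩ :=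
      hg.exists_met_eq_U_of_mem_policiesAgreeing h0 hk₀ hmem φ hs.le hlt
    have hmk := h'.succ_le_of_met_eq_U φ hm hs.le h1 hmet
    exact (by_contra fun hne => hdev k hmk hk ⟨_, hmet, hne⟩ : _ = πg _).trans (if_pos hlt).symm
  · exact (if_neg hlt).symm

lemma le_deltaMax {πg π : Policy d} {k : ℕ} (h : π ∈ policiesAgreeing K πg k) :
    expectedReward K πg - expectedReward K π ≤ deltaMax K πg k := by
  refine le_csSup ⟨expectedReward K πg, ?_⟩ ⟨π, h, rfl⟩
  rintro _ ⟨π', -, rfl⟩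
  exact sub_le_self _ (expectedReward_nonneg K π')

lemma deltaMax_nonneg (K : ℕ) (πg : Policy d) (k : ℕ) : 0 ≤ deltaMax K πg k := by
  simpa using le_deltaMax (K := K) (πg := πg) (π := πg) (k := k) fun _ _ _ => rfl

open Classical in
lemma IsGreedy.expectedReward_sub_le {πg π : Policy d} (hg : IsGreedy πg)
    (h : PrefersUnexplored π) (hK : m ≤ K) :
    expectedReward K πg - expectedReward K π ≤
      ∑ k ∈ Finset.Icc (m + 1) (min K (∑ i, d i)),
        {k | Deviates K πg π k}.indicator (deltaMax K πg) k := by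
  have hnonneg (k : ℕ) : 0 ≤ {k | Deviates K πg π k}.indicator (deltaMax K πg) k :=
    Set.indicator_nonneg (fun k _ => deltaMax_nonneg K πg k) k
  by_cases hex : ∃ k, k ∈ Finset.Icc (m + 1) (min K (∑ i, d i)) ∧ Deviates K πg π k
  · obtain ⟨hk, hdev⟩ := Nat.find_spec hex
    have hk' := Finset.mem_Icc.1 hk
    obtain ⟨π', hπ', hr⟩ := hg.exists_mem_policiesAgreeing h hK (by omega) hk'.2
      fun k hmk hlt hd => Nat.find_min hex hlt ⟨Finset.mem_Icc.2 ⟨hmk, by omega⟩, hd⟩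
    rw [hr]
    exact (le_deltaMax hπ').trans ((Set.indicator_of_mem (s := {k | Deviates K πg π k}) hdev
      (deltaMax K πg)).symm.trans_le (Finset.single_le_sum (fun k _ => hnonneg k) hk))
  · push Not at hex
    rw [hg.expectedReward_eq_of_not_deviates h hK hex, sub_self]
    exact Finset.sum_nonneg fun k _ => hnonneg k

end Greedy

/-! ### Choices of the algorithm that are not greedy -/

/-- The gap between the indices `1 - μ_j c_j` and `1 - μ_i c_i`, spread over the `c_i + c_j`
members: exploring `C_i` rather than `C_j` requires an estimate that is off by this much. With
`c_i = U_{i,k}` and `j = i^*_k` it is `ε_{i,k}`. -/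
noncomputable def relGap (d c : Fin m → ℕ) (i j : Fin m) : ℝ :=
  (mu d i * c i - mu d j * c j) / (c i + c j)

lemma relGap_pos_iff {c : Fin m → ℕ} {i j : Fin m} :
    0 < relGap d c i j ↔ mu d j * c j < mu d i * c i := by
  rw [← sub_pos (a := mu d i * c i)]
  refine ⟨fun h => ?_, fun h => div_pos h ?_⟩
  · contrapose! h
    exact div_nonpos_of_nonpos_of_nonneg h (by positivity)
  · have hj : 0 ≤ mu d j * c j := mul_nonneg (mu_nonneg d j) (Nat.cast_nonneg _)
    have hi : (0 : ℝ) < c i := pos_of_mul_pos_right (by linarith) (mu_nonneg d i)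
    positivity

lemma exists_pos_le_relGap (d : Fin m → ℕ) :
    ∃ ε > 0, ∀ c ≤ d, ∀ i j, 0 < relGap d c i j → ε ≤ relGap d c i j := by
  let gaps : Set ℝ := (fun x : (Fin m → ℕ) × Fin m × Fin m => relGap d x.1 x.2.1 x.2.2) ''
    Set.Iic d ×ˢ Set.univ
  have hfin : gaps.Finite := ((Set.finite_Iic d).prod Set.finite_univ).image _
  obtain ⟨ε, hε, hle⟩ := Set.Finite.exists_between' (Set.finite_singleton (0 : ℝ))
    (hfin.inter_of_left (Set.Ioi 0)) (by rintro _ rfl y hy; exact hy.2)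
  exact ⟨ε, hε 0 rfl, fun c hc i j hpos => (hle _ ⟨⟨(c, i, j), ⟨hc, trivial⟩, rfl⟩, hpos⟩).le⟩

lemma IsFullInfoCLCB.relGap_le {A : Learner d} (hA : IsFullInfoCLCB A) (h : Feedback d)
    (ψ : PartialRealization d) {j : Fin m} (hpos : 0 < relGap d (met ψ) (A h ψ) j) :
    relGap d (met ψ) (A h ψ) j ≤ muHat h j - mu d j ∨
      relGap d (met ψ) (A h ψ) j ≤ mu d (A h ψ) - muHat h (A h ψ) := by
  have hchoice := (hA h ψ).1 j
  generalize A h ψ = a at *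
  have hj : (0 : ℝ) ≤ met ψ j := Nat.cast_nonneg _
  have ha : (0 : ℝ) < met ψ a :=
    pos_of_mul_pos_right ((mul_nonneg (mu_nonneg d j) hj).trans_lt (relGap_pos_iff.1 hpos))
      (mu_nonneg d a)
  have hgap : relGap d (met ψ) a j * (met ψ a + met ψ j) = mu d a * met ψ a - mu d j * met ψ j :=
    div_mul_cancel₀ _ (by positivity)
  by_contra! hclose
  nlinarith [mul_lt_mul_of_pos_left hclose.2 ha, mul_le_mul_of_nonneg_left hclose.1.le hj]

lemma IsFullInfoCLCB.prefersUnexplored {A : Learner d} (hA : IsFullInfoCLCB A) (h : Feedback d) :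
    PrefersUnexplored (A h) := fun ψ => (hA h ψ).2

lemma exists_relGap_pos_of_not_isBest {ψ : PartialRealization d} {i : Fin m}
    (h : ¬ IsBest ψ i) : ∃ j, 0 < relGap d (met ψ) i j := by
  simpa only [relGap_pos_iff, IsBest, not_forall, not_le] using h

lemma IsGreedy.eq_of_relGap_pos {πg : Policy d} (hg : IsGreedy πg) {ψ : PartialRealization d}
    {j : Fin m} (h : ∀ i ≠ j, 0 < relGap d (met ψ) i j) : πg ψ = j := by
  by_contra hne
  exact (hg.isBest ψ j).not_gt (relGap_pos_iff.1 (h _ hne))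

lemma mu_le_one (d : Fin m → ℕ) (i : Fin m) : mu d i ≤ 1 := by
  simpa [mu] using Nat.cast_inv_le_one (α := ℝ) (d i)

lemma relGap_le_one (d c : Fin m → ℕ) (i j : Fin m) : relGap d c i j ≤ 1 := by
  refine div_le_one_of_le₀ ?_ (by positivity)
  have hi : mu d i * c i ≤ c i := mul_le_of_le_one_left (Nat.cast_nonneg _) (mu_le_one d i)
  have hj : 0 ≤ mu d j * c j := mul_nonneg (mu_nonneg d j) (Nat.cast_nonneg _)
  linarith [(Nat.cast_nonneg (c j) : (0 : ℝ) ≤ c j)]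

/-! ### The regret -/

variable [∀ i, NeZero (d i)]

lemma regret_eq_sum (K : ℕ) (πstar : Policy d) (A : Learner d) (T : ℕ) :
    regret K πstar A T = ∑ t ∈ Finset.range T,
      feedbackMean K A t fun h => expectedReward K πstar - expectedReward K (A h) := by
  rw [regret, expect_sum_take fun (φs : List (Realization d K)) φ =>
    reward (explored πstar φ K) φ - reward (explored (A (feedback A φs)) φ K) φ]
  exact Finset.sum_congr rfl fun t _ => Finset.expect_congr rfl fun Φ _ =>
    Finset.expect_sub_distrib ..

lemma regret_nonneg {πstar : Policy d} (hopt : IsOptimal K πstar) (A : Learner d) (T : ℕ) :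
    0 ≤ regret K πstar A T := by
  rw [regret_eq_sum]
  exact Finset.sum_nonneg fun t _ => Finset.expect_nonneg fun _ _ => sub_nonneg.2 (hopt _)

lemma exists_regret_le (hK : m ≤ K) (πstar : Policy d) :
    ∃ C, ∀ A : Learner d, IsFullInfoCLCB A → ∀ T, regret K πstar A T ≤ C := by
  obtain ⟨ε, hε, hgap⟩ := exists_pos_le_relGap d
  refine ⟨expectedReward K πstar * (1 + ∑ _i : Fin m, (2 + 1 / ε ^ 2)), fun A hA T => ?_⟩
  let E : Set (Feedback d) := {h | ¬ ∀ ψ, IsBest ψ (A h ψ)}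
  have hE : ∀ h ∈ E, ∃ i ∈ Finset.univ,
      ε ≤ muHat h i - mu d i ∨ ε ≤ mu d i - muHat h i := fun h hh => by
    obtain ⟨ψ, hψ⟩ := not_forall.1 hh
    obtain ⟨j, hj⟩ := exists_relGap_pos_of_not_isBest hψ
    have hle := hgap _ (met_le ψ) _ _ hj
    obtain hdev | hdev := hA.relGap_le h ψ hj
    · exact ⟨j, Finset.mem_univ j, .inl (hle.trans hdev)⟩
    · exact ⟨_, Finset.mem_univ _, .inr (hle.trans hdev)⟩
  have hloss (h : Feedback d) : expectedReward K πstar - expectedReward K (A h)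
      ≤ expectedReward K πstar * E.indicator 1 h := by
    by_cases hh : h ∈ E
    · simpa [hh] using expectedReward_nonneg K (A h)
    · simpa [hh] using isOptimal_of_isBest K (not_not.1 hh) πstar
  calc regret K πstar A T
      ≤ ∑ t ∈ Finset.range T,
          feedbackMean K A t fun h => expectedReward K πstar * E.indicator 1 h :=
        (regret_eq_sum ..).trans_le
          (Finset.sum_le_sum fun t _ => feedbackMean_mono fun _ _ => hloss _)
    _ = expectedReward K πstar * ∑ t ∈ Finset.range T, feedbackProb K A t E := by
        simp only [feedbackProb, feedbackMean, Finset.mul_expect, Finset.mul_sum]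
    _ ≤ _ := mul_le_mul_of_nonneg_left (sum_feedbackProb_le hA.prefersUnexplored hK id id
        (fun _ _ => hε) hE T) (expectedReward_nonneg K πstar)

lemma IsGreedy.regret_le_sum_deltaMax {πg : Policy d} (hg : IsGreedy πg) (πstar : Policy d)
    {A : Learner d} (hA : ∀ h, PrefersUnexplored (A h)) (hK : m ≤ K) (T : ℕ) :
    regret K πstar A T ≤ ∑ k ∈ Finset.Icc (m + 1) (min K (∑ i, d i)),
      (∑ t ∈ Finset.range T, feedbackProb K A t {h | Deviates K πg (A h) k}) *
        deltaMax K πg k := by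
  let loss (h : Feedback d) : ℝ := ∑ k ∈ Finset.Icc (m + 1) (min K (∑ i, d i)),
    {h | Deviates K πg (A h) k}.indicator 1 h * deltaMax K πg k
  have hloss (h : Feedback d) : expectedReward K πstar - expectedReward K (A h) ≤ loss h := by
    have hopt := isOptimal_of_isBest K hg.isBest πstar
    refine (sub_le_sub_right hopt _).trans ((hg.expectedReward_sub_le (hA h) hK).trans_eq ?_)
    refine Finset.sum_congr rfl fun k _ => ?_
    by_cases hk : Deviates K πg (A h) k <;> simp [hk]
  calc regret K πstar A T
      ≤ ∑ t ∈ Finset.range T, feedbackMean K A t loss :=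
        (regret_eq_sum ..).trans_le
          (Finset.sum_le_sum fun t _ => feedbackMean_mono fun _ _ => hloss _)
    _ = _ := by
        simp only [loss, feedbackMean, feedbackProb, Finset.expect_sum_comm, Finset.sum_mul,
          Finset.expect_mul]
        exact Finset.sum_comm

lemma exists_deviation_of_deviates {πg : Policy d} (hg : IsGreedy πg) {A : Learner d}
    (hA : IsFullInfoCLCB A) {h : Feedback d} {k : ℕ} {istar : Fin m}
    (hε : ∀ i ∈ Finset.univ.erase istar, 0 < relGap d (U K πg k) i istar)
    (hdev : Deviates K πg (A h) k) :
    ∃ i ∈ Finset.univ.erase istar,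
      relGap d (U K πg k) i istar ≤ muHat h istar - mu d istar ∨
        relGap d (U K πg k) i istar ≤ mu d i - muHat h i := by
  obtain ⟨ψ, hψ, hne⟩ := hdev
  simp only [← hψ, Finset.mem_erase, Finset.mem_univ, and_true] at hε ⊢
  rw [hg.eq_of_relGap_pos hε] at hne
  exact ⟨A h ψ, hne, hA.relGap_le h ψ (hε _ hne)⟩

lemma two_add_inv_sq_le {ε : ℝ} (h0 : 0 < ε) (h1 : ε ≤ 1) :
    2 + 1 / ε ^ 2 ≤ 2 / ε ^ 4 + 1 := by
  have h2 : 1 ≤ 1 / ε ^ 2 := one_le_one_div (by positivity) (pow_le_one₀ h0.le h1)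
  have h3 : 2 / ε ^ 4 = 2 * (1 / ε ^ 2) ^ 2 := by ring
  nlinarith

lemma ofReal_two_add_inv_relGap_sq_le {πg : Policy d} {k : ℕ} {i istar : Fin m}
    (hi : i ≠ istar) (hpos : 0 < relGap d (U K πg k) i istar) :
    ENNReal.ofReal (2 + 1 / relGap d (U K πg k) i istar ^ 2)
      ≤ 2 / eps K πg k istar i ^ 4 + 1 := by
  have heps : eps K πg k istar i = ENNReal.ofReal (relGap d (U K πg k) i istar) := if_neg hi
  refine (ENNReal.ofReal_le_ofReal (two_add_inv_sq_le hpos (relGap_le_one ..))).trans_eq ?_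
  rw [heps, ENNReal.ofReal_add (by positivity) zero_le_one,
    ENNReal.ofReal_div_of_pos (by positivity), ENNReal.ofReal_pow hpos.le]
  simp

lemma IsGreedy.ofReal_sum_feedbackProb_deviates_le {πg : Policy d} (hg : IsGreedy πg)
    {A : Learner d} (hA : IsFullInfoCLCB A) (hK : m ≤ K) (k : ℕ) (istar : Fin m) (T : ℕ) :
    ENNReal.ofReal (∑ t ∈ Finset.range T, feedbackProb K A t {h | Deviates K πg (A h) k})
      ≤ ∑ i, (2 / eps K πg k istar i ^ 4 + 1) := by
  by_cases hε : ∀ i ∈ Finset.univ.erase istar, 0 < relGap d (U K πg k) i istar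
  · have hprob := sum_feedbackProb_le hA.prefersUnexplored hK (fun _ => istar) id hε
      (fun h hdev => exists_deviation_of_deviates hg hA hε hdev) T
    refine (ENNReal.ofReal_le_ofReal hprob).trans ?_
    rw [← Finset.add_sum_erase _ _ (Finset.mem_univ istar),
      ENNReal.ofReal_add zero_le_one (Finset.sum_nonneg fun i _ => by positivity),
      ENNReal.ofReal_sum_of_nonneg fun i _ => by positivity]
    exact add_le_add (by simp [eps]) (Finset.sum_le_sum fun i hi =>
      ofReal_two_add_inv_relGap_sq_le (Finset.ne_of_mem_erase hi) (hε i hi))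
  · push Not at hε
    obtain ⟨i, hi, hle⟩ := hε
    have heps : eps K πg k istar i = 0 :=
      (if_neg (Finset.ne_of_mem_erase hi)).trans (ENNReal.ofReal_of_nonpos hle)
    have htop : 2 / eps K πg k istar i ^ 4 + 1 = ⊤ := by
      rw [heps, zero_pow four_ne_zero, ENNReal.div_zero two_ne_zero, top_add]
    rw [ENNReal.sum_eq_top.2 ⟨i, Finset.mem_univ i, htop⟩]
    exact le_top

lemma IsGreedy.ofReal_regret_le {πg : Policy d} (hg : IsGreedy πg) (πstar : Policy d)
    {A : Learner d} (hA : IsFullInfoCLCB A) (hK : m ≤ K) (istar : ℕ → Fin m) (T : ℕ) :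
    ENNReal.ofReal (regret K πstar A T) ≤
      ∑ i : Fin m, ∑ k ∈ Finset.Icc (m + 1) (min K (∑ j, d j)),
        (2 / eps K πg k (istar k) i ^ 4 + 1) * ENNReal.ofReal (deltaMax K πg k) := by
  have hle := hg.regret_le_sum_deltaMax πstar hA.prefersUnexplored hK T
  refine (ENNReal.ofReal_le_ofReal hle).trans ?_
  refine (Finset.le_sum_of_subadditive _ ENNReal.ofReal_zero.le
    (fun _ _ => ENNReal.ofReal_add_le) _ _).trans ?_
  rw [Finset.sum_comm]
  refine Finset.sum_le_sum fun k _ => ?_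
  rw [ENNReal.ofReal_mul' (deltaMax_nonneg K πg k), ← Finset.sum_mul]
  gcongr
  exact hg.ofReal_sum_feedbackProb_deviates_le hA hK k (istar k) T

section Randomized

variable {Ξ : Type*} [MeasurableSpace Ξ] (ν : Measure Ξ) [IsProbabilityMeasure ν]

lemma randomizedRegret_le {πstar : Policy d} (hopt : IsOptimal K πstar) {A : Ξ → Learner d}
    {T : ℕ} {C : ℝ} (h : ∀ ξ, regret K πstar (A ξ) T ≤ C) :
    randomizedRegret ν K πstar A T ≤ C :=
  calc randomizedRegret ν K πstar A T ≤ ∫ _, C ∂ν :=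
        integral_mono_of_nonneg (.of_forall fun ξ => regret_nonneg hopt (A ξ) T)
          (integrable_const C) (.of_forall h)
    _ = C := by simp

lemma ofReal_randomizedRegret_le {πstar : Policy d} (hopt : IsOptimal K πstar)
    {A : Ξ → Learner d} {T : ℕ} {B : ℝ≥0∞}
    (h : ∀ ξ, ENNReal.ofReal (regret K πstar (A ξ) T) ≤ B) :
    ENNReal.ofReal (randomizedRegret ν K πstar A T) ≤ B := by
  obtain rfl | hB := eq_or_ne B ⊤
  · exact le_top
  · simp only [ENNReal.ofReal_le_iff_le_toReal hB] at h ⊢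
    exact randomizedRegret_le ν hopt h

end Randomized

end CommunityExploration

open CommunityExploration in
theorem theorem6 {m : ℕ} (d : Fin m → ℕ) [∀ i, NeZero (d i)] (K : ℕ) (hK : m < K)
    (πstar : Policy d) (hopt : IsOptimal K πstar) :
    (∃ C : ℝ, ∀ (Ξ : Type*) [MeasurableSpace Ξ] (ν : Measure Ξ) [IsProbabilityMeasure ν]
      (A : Ξ → Learner d), (∀ ξ, IsFullInfoCLCB (A ξ)) →
      (∀ h ψ, Measurable (fun ξ => A ξ h ψ)) →
      ∀ T : ℕ, randomizedRegret ν K πstar A T ≤ C) ∧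
    (∀ πg : Policy d, IsGreedy πg →
      ∀ istar : ℕ → Fin m,
      (∀ k ∈ Finset.Icc (m + 1) (min K (∑ i, d i)), IsArgmin K πg k (istar k)) →
      ∀ (Ξ : Type*) [MeasurableSpace Ξ] (ν : Measure Ξ) [IsProbabilityMeasure ν]
      (A : Ξ → Learner d), (∀ ξ, IsFullInfoCLCB (A ξ)) →
      (∀ h ψ, Measurable (fun ξ => A ξ h ψ)) →
      ∀ T : ℕ, ENNReal.ofReal (randomizedRegret ν K πstar A T) ≤
        ∑ i : Fin m, ∑ k ∈ Finset.Icc (m + 1) (min K (∑ j, d j)),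
          (2 / eps K πg k (istar k) i ^ 4 + 1) * ENNReal.ofReal (deltaMax K πg k)) := by
  constructor
  · obtain ⟨C, hC⟩ := exists_regret_le hK.le πstar
    exact ⟨C, fun Ξ _ ν _ A hA _ T => randomizedRegret_le ν hopt fun ξ => hC (A ξ) (hA ξ) T⟩
  · intro πg hg istar _ Ξ _ ν _ A hA _ T
    exact ofReal_randomizedRegret_le ν hopt fun ξ =>
      hg.ofReal_regret_le πstar (hA ξ) hK.le istar T
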